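/- Let $\mathcal H_A=\mathbb C^{d_A}$, $\mathcal H_B=\mathbb C^{d_B}$ with $d_A,d_B\ge 1$, let $d=d_Ad_B$, and let $\rho$ be a density matrix (positive semidefinite, trace one) on $\mathcal H_A\otimes\mathcal H_B$. Let $\mu$ be the Haar probability measure on the unitary group $U(d)$, let $S(\sigma)=-\operatorname{Tr}(\sigma\ln\sigma)$ be the von Neumann entropy (with $0\ln 0=0$), and for $U\in U(d)$ put $\rho'_A=\operatorname{Tr}_B(U\rho U^\dagger)$. Let $\Gamma(X)=\operatorname{Tr}_B(X)\otimes \mathbb 1_B$, $T=\frac{1}{d_B}\mathbb 1_A\otimes\mathbb 1_B-\rho$, and $$a_n=\operatorname{Tr}\Big[\rho\int U^\dagger\,[\Gamma(UTU^\dagger)]^n\,U\,d\mu(U)\Big].$$ Then the integrals exist, all $a_n$ are real, and for every $n\in\mathbb N$ $$\int S(\rho'_A)\,d\mu(U)\ \ge\ a_1+\frac{a_2}{2}+\dots+\frac{a_n}{n},\qquad a_n\ge a_1^n .$$ The first two terms are given explicitly: if $d\ge 2$, $$a_1=\frac{d_A-1}{d^2-1}\Big[(1+d\,d_B)-(d+d_B)\operatorname{Tr}\rho^2\Big],$$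 and if $d\ge 3$, $$a_2=\Big(f+\frac{g}{d_B}+\frac{h}{d_B^2}\Big)-\Big(g+\frac{2h}{d_B}\Big)\operatorname{Tr}\rho^2+h\operatorname{Tr}\rho^3,$$ where $$f=\frac{d_A(d_A^2-1)(d_B^2-1)}{(d^2-1)(d^2-4)}\big(d_A+d_B\operatorname{Tr}\rho^2-2\big)+\frac{(d^2-2d_A^2-2)(d_B^2-1)}{(d^2-1)(d^2-4)}(d_A-1)^2,$$ $$g=\frac{2d(d_A-1)(d_A^2-1)(d_B^2-1)}{(d^2-1)(d^2-4)},\qquad h=\frac{(d_A^2-1)(d_A^2-4)d_B^2}{(d^2-1)(d^2-4)}.$$ Moreover $a_1<1$ and $$\int S(\rho'_A)\,d\mu(U)\ \ge\ -\ln(1-a_1).$$ -/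

import Mathlib

open MeasureTheory Matrix
open scoped Kronecker ComplexOrder

noncomputable section

namespace UnitaryOrbit

/-- The unitary group is compact: it is closed and its entries are bounded by `1`. -/
instance compactSpace_unitaryGroup {ι : Type*} [Fintype ι] [DecidableEq ι] :
    CompactSpace (Matrix.unitaryGroup ι ℂ) := by
  have hK : IsCompact {M : Matrix ι ι ℂ | ∀ i j, M i j ∈ Metric.closedBall (0 : ℂ) 1} := by
    have h : IsCompact (Set.univ.pi fun _ : ι => Set.univ.pi
        fun _ : ι => Metric.closedBall (0 : ℂ) 1) := isCompact_univ_pi fun _ =>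
      isCompact_univ_pi fun _ => isCompact_closedBall (0 : ℂ) 1
    have e : {M : Matrix ι ι ℂ | ∀ i j, M i j ∈ Metric.closedBall (0 : ℂ) 1} =
        Set.univ.pi fun _ : ι => Set.univ.pi fun _ : ι => Metric.closedBall (0 : ℂ) 1 :=
      Set.ext fun M => ⟨fun hM i _ j _ => hM i j, fun hM i j => hM i trivial j trivial⟩
    rw [e]
    exact h
  refine isCompact_iff_compactSpace.mp
    (hK.of_isClosed_subset (isClosed_unitary (R := Matrix ι ι ℂ)) ?_)
  intro U hU i j
  simpa using entry_norm_bound_of_unitary hU i j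

/-- The Borel σ-algebra on the unitary group. -/
instance measurableSpace_unitaryGroup {ι : Type*} [Fintype ι] [DecidableEq ι] :
    MeasurableSpace (Matrix.unitaryGroup ι ℂ) := borel _

instance borelSpace_unitaryGroup {ι : Type*} [Fintype ι] [DecidableEq ι] :
    BorelSpace (Matrix.unitaryGroup ι ℂ) := ⟨rfl⟩

/-- The Haar probability measure `μ` on the unitary group: the Haar measure for which the
whole (compact) group has measure `1`. -/
def haarU (ι : Type*) [Fintype ι] [DecidableEq ι] : Measure (Matrix.unitaryGroup ι ℂ) :=
  Measure.haarMeasure ⊤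

/-- A density matrix: positive semidefinite with trace one. -/
def IsDensity {ι : Type*} [Fintype ι] (ρ : Matrix ι ι ℂ) : Prop :=
  ρ.PosSemidef ∧ ρ.trace = 1

/-- The von Neumann entropy `S(ρ) = -Tr (ρ ln ρ)`, with the logarithm taken by functional
calculus; since `Real.log 0 = 0`, zero eigenvalues contribute `0 ln 0 = 0`. -/
def entropy {ι : Type*} [Fintype ι] [DecidableEq ι] (ρ : Matrix ι ι ℂ) : ℝ :=
  -((ρ * cfc Real.log ρ).trace).re

section Bipartite

variable {A B : Type*} [Fintype A] [DecidableEq A] [Fintype B] [DecidableEq B]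

/-- The partial trace over `B`. -/
def ptraceB (X : Matrix (A × B) (A × B) ℂ) : Matrix A A ℂ :=
  Matrix.of fun i j => ∑ k : B, X (i, k) (j, k)

/-- `Γ(X) = Tr_B(X) ⊗ 1_B`. -/
def Gam (X : Matrix (A × B) (A × B) ℂ) : Matrix (A × B) (A × B) ℂ :=
  ptraceB X ⊗ₖ (1 : Matrix B B ℂ)

/-- `T = (1_A ⊗ 1_B) / d_B - ρ`. -/
def Tmat (ρ : Matrix (A × B) (A × B) ℂ) : Matrix (A × B) (A × B) ℂ :=
  ((Fintype.card B : ℂ)⁻¹) • (1 : Matrix (A × B) (A × B) ℂ) - ρ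

/-- The marginal `ρ'_A = Tr_B (U ρ U†)`. -/
def marginal (ρ : Matrix (A × B) (A × B) ℂ) (U : Matrix.unitaryGroup (A × B) ℂ) :
    Matrix A A ℂ :=
  ptraceB ((U : Matrix (A × B) (A × B) ℂ) * ρ * (U : Matrix (A × B) (A × B) ℂ)ᴴ)

/-- The integrand `U† [Γ(U T U†)]ⁿ U`. -/
def integrand (ρ : Matrix (A × B) (A × B) ℂ) (n : ℕ) (U : Matrix.unitaryGroup (A × B) ℂ) :
    Matrix (A × B) (A × B) ℂ :=
  (U : Matrix (A × B) (A × B) ℂ)ᴴ *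
    Gam ((U : Matrix (A × B) (A × B) ℂ) * Tmat ρ * (U : Matrix (A × B) (A × B) ℂ)ᴴ) ^ n *
      (U : Matrix (A × B) (A × B) ℂ)

/-- The (entrywise) matrix integral `∫ U† [Γ(U T U†)]ⁿ U dμ(U)`. -/
def integralMat (ρ : Matrix (A × B) (A × B) ℂ) (n : ℕ) : Matrix (A × B) (A × B) ℂ :=
  Matrix.of fun x y => ∫ U, integrand ρ n U x y ∂(haarU (A × B))

/-- The complex number `Tr [ρ ∫ U† [Γ(U T U†)]ⁿ U dμ(U)]`. -/
def aTrace (ρ : Matrix (A × B) (A × B) ℂ) (n : ℕ) : ℂ :=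
  (ρ * integralMat ρ n).trace

/-- The real number `a_n`. -/
def a (ρ : Matrix (A × B) (A × B) ℂ) (n : ℕ) : ℝ := (aTrace ρ n).re

/-- `Tr (ρᵏ)` as a real number. -/
def trPow {ι : Type*} [Fintype ι] [DecidableEq ι] (ρ : Matrix ι ι ℂ) (k : ℕ) : ℝ :=
  ((ρ ^ k).trace).re

end Bipartite

/-- The coefficient `f`, with `d = dA dB` and `p = Tr ρ²`. -/
def coeffF (dA dB p : ℝ) : ℝ :=
  dA * (dA ^ 2 - 1) * (dB ^ 2 - 1) / (((dA * dB) ^ 2 - 1) * ((dA * dB) ^ 2 - 4))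
      * (dA + dB * p - 2)
    + ((dA * dB) ^ 2 - 2 * dA ^ 2 - 2) * (dB ^ 2 - 1)
      / (((dA * dB) ^ 2 - 1) * ((dA * dB) ^ 2 - 4)) * (dA - 1) ^ 2

/-- The coefficient `g`. -/
def coeffG (dA dB : ℝ) : ℝ :=
  2 * (dA * dB) * (dA - 1) * (dA ^ 2 - 1) * (dB ^ 2 - 1)
    / (((dA * dB) ^ 2 - 1) * ((dA * dB) ^ 2 - 4))

/-- The coefficient `h`. -/
def coeffH (dA dB : ℝ) : ℝ :=
  (dA ^ 2 - 1) * (dA ^ 2 - 4) * dB ^ 2 / (((dA * dB) ^ 2 - 1) * ((dA * dB) ^ 2 - 4))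

end UnitaryOrbit

end

/-!
Write `R = Tr_B (U ρ U†)` for the marginal. Since `Tr_B (1 / d_B) = 1_A`, the matrix
`Γ(U T U†)` is `(1 - R) ⊗ 1_B`, and so `a_n` is the Haar average of the real number
`Tr [R (1 - R)ⁿ]` (`a_eq_integral`). In terms of the eigenvalues `t` of `R`, which form a
probability vector, this number is `∑ t (1 - t)ⁿ`. The expansion `-t ln t = ∑ t (1 - t)ᵏ / k`
has nonnegative terms on `[0, 1]`, and its partial sums give the lower bounds for the mean entropy
(`sum_a_le_integral_entropy`); it also exhibits the entropy as a limit of continuous functions of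
`U`, hence measurable. Jensen's inequality, for the eigenvalues and then for the Haar measure,
gives `a_1 ^ n ≤ a_n` (`a_one_pow_le`). As `Tr R² ≥ 1 / d_A`, one has `0 ≤ a_1 < 1`, and summing
`a_1 ^ k / k` gives the logarithmic bound (`neg_log_one_sub_a_one_le`).

The explicit formulas for `a_1` and `a_2` need the Haar averages of `Tr R²` and `Tr R³`, that is,
the second and third moments of the entries of `X = U ρ U†`. Left invariance of the Haar measure
makes the law of `X` invariant under conjugation by unitaries, and three kinds of unitaries suffice
to find the shape of the moments: diagonal ones kill every moment whose row and column indices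
are not rearrangements of each other; permutation matrices make the others depend only on the
pattern of the indices; and a square root of a transposition matrix (`sqrtSwap`) relates the
patterns with repeated indices to those without. Hence `E[X ⊗ X]` and `E[X ⊗ X ⊗ X]` are
combinations of permutation operators with coefficients constant on conjugacy classes
(`IsInvariant.exists_moment_two`, `IsInvariant.exists_moment_three`). The coefficients solve the
linear system given by `Tr X = 1`, `Tr X² = Tr ρ²` and `Tr X³ = Tr ρ³`, which is invertible for
`d ≥ 2`, respectively `d ≥ 3`, and contracting with the partial trace gives the averages
(`IsInvariant.expect_marginal_sq`, `IsInvariant.expect_marginal_cube`).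
-/

namespace UnitaryOrbit

/-! ### Index patterns -/

section Indices

variable {ι : Type*} [DecidableEq ι]

/-- The contribution of the index `i` to the multiplicity of `z` in a list of indices. -/
def ind (z i : ι) : ℕ := if i = z then 1 else 0

/-- The Kronecker delta, as a complex number. -/
def dl (i j : ι) : ℂ := if i = j then 1 else 0

@[simp] lemma dl_self (i : ι) : dl i i = 1 := if_pos rfl

lemma dl_comm (i j : ι) : dl i j = dl j i := by simp only [dl, eq_comm]

lemma dl_mul_dl_eq_zero {i₁ j₁ i₂ j₂ : ι} (h : ¬(i₁ = j₁ ∧ i₂ = j₂)) :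
    dl i₁ j₁ * dl i₂ j₂ = 0 := by
  simp only [dl]; grind

lemma dl_mul_dl_mul_dl_eq_zero {i₁ j₁ i₂ j₂ i₃ j₃ : ι} (h : ¬(i₁ = j₁ ∧ i₂ = j₂ ∧ i₃ = j₃)) :
    dl i₁ j₁ * dl i₂ j₂ * dl i₃ j₃ = 0 := by
  simp only [dl]; grind

lemma eq_perm_of_ind_add_eq {i₁ j₁ i₂ j₂ : ι}
    (h : ∀ z, ind z i₁ + ind z i₂ = ind z j₁ + ind z j₂) :
    (j₁ = i₁ ∧ j₂ = i₂) ∨ (j₁ = i₂ ∧ j₂ = i₁) := by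
  have h1 := h i₁
  have h2 := h i₂
  simp only [ind] at h1 h2
  grind

lemma eq_perm_of_ind_add_add_eq {i₁ j₁ i₂ j₂ i₃ j₃ : ι}
    (h : ∀ z, ind z i₁ + ind z i₂ + ind z i₃ = ind z j₁ + ind z j₂ + ind z j₃) :
    (j₁ = i₁ ∧ j₂ = i₂ ∧ j₃ = i₃) ∨ (j₁ = i₁ ∧ j₂ = i₃ ∧ j₃ = i₂) ∨
      (j₁ = i₃ ∧ j₂ = i₂ ∧ j₃ = i₁) ∨ (j₁ = i₂ ∧ j₂ = i₁ ∧ j₃ = i₃) ∨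
      (j₁ = i₂ ∧ j₂ = i₃ ∧ j₃ = i₁) ∨ (j₁ = i₃ ∧ j₂ = i₁ ∧ j₃ = i₂) := by
  have hj : j₁ = i₁ ∨ j₁ = i₂ ∨ j₁ = i₃ := by
    have h1 := h j₁
    simp only [ind] at h1
    grind
  rcases hj with rfl | rfl | rfl
  · rcases eq_perm_of_ind_add_eq (i₁ := i₂) (i₂ := i₃) (j₁ := j₂) (j₂ := j₃)
      (fun z => by have := h z; omega) with h' | h' <;> tauto
  · rcases eq_perm_of_ind_add_eq (i₁ := i₁) (i₂ := i₃) (j₁ := j₂) (j₂ := j₃)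
      (fun z => by have := h z; omega) with h' | h' <;> tauto
  · rcases eq_perm_of_ind_add_eq (i₁ := i₁) (i₂ := i₂) (j₁ := j₂) (j₂ := j₃)
      (fun z => by have := h z; omega) with h' | h' <;> tauto

lemma exists_perm_two {a b a' b' : ι} (h : a ≠ b) (h' : a' ≠ b') :
    ∃ σ : Equiv.Perm ι, σ a = a' ∧ σ b = b' := by
  have h1 : Equiv.swap a a' b ≠ a' := fun e => h (by
    simpa using congrArg (Equiv.swap a a') e.symm)
  refine ⟨(Equiv.swap a a').trans (Equiv.swap (Equiv.swap a a' b) b'), ?_, ?_⟩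
  · simp [Equiv.swap_apply_of_ne_of_ne h1.symm h']
  · simp

lemma exists_perm_three {a b c a' b' c' : ι} (hab : a ≠ b) (hac : a ≠ c) (hbc : b ≠ c)
    (hab' : a' ≠ b') (hac' : a' ≠ c') (hbc' : b' ≠ c') :
    ∃ σ : Equiv.Perm ι, σ a = a' ∧ σ b = b' ∧ σ c = c' := by
  obtain ⟨σ, rfl, rfl⟩ := exists_perm_two hab hab'
  refine ⟨σ.trans (Equiv.swap (σ c) c'), ?_, ?_, ?_⟩
  · simp [Equiv.swap_apply_of_ne_of_ne (σ.injective.ne hac) hac']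
  · simp [Equiv.swap_apply_of_ne_of_ne (σ.injective.ne hbc) hbc']
  · simp

end Indices

/-! ### Special unitary matrices -/

section Unitaries

variable {ι : Type*} [Fintype ι] [DecidableEq ι]

lemma diagonal_mem_unitaryGroup {φ : ι → ℂ} (hφ : ∀ i, φ i * star (φ i) = 1) :
    diagonal φ ∈ Matrix.unitaryGroup ι ℂ := by
  rw [mem_unitaryGroup_iff, star_eq_conjTranspose, diagonal_conjTranspose, diagonal_mul_diagonal]
  rw [← diagonal_one]
  exact congrArg diagonal (funext hφ)

lemma permMatrix_mem_unitaryGroup (σ : Equiv.Perm ι) :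
    σ.permMatrix ℂ ∈ Matrix.unitaryGroup ι ℂ := by
  rw [mem_unitaryGroup_iff, star_eq_conjTranspose, conjTranspose_permMatrix, ← permMatrix_mul]
  simp

/-- The matrix `(1 + i)/2 + (1 - i)/2 P`, where `P` is the permutation matrix of the
transposition of `x` and `y`: a square root of `P`, which mixes the basis vectors `x` and `y`
with weights of equal modulus and fixes the others. -/
noncomputable def sqrtSwap (x y : ι) : Matrix ι ι ℂ :=
  ((1 + Complex.I) / 2) • (1 : Matrix ι ι ℂ) +
    ((1 - Complex.I) / 2) • (Equiv.swap x y).permMatrix ℂ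

lemma sqrtSwap_mem_unitaryGroup (x y : ι) : sqrtSwap x y ∈ Matrix.unitaryGroup ι ℂ := by
  have hP : (Equiv.swap x y).permMatrix ℂ * (Equiv.swap x y).permMatrix ℂ = 1 := by
    rw [← permMatrix_mul]; simp
  rw [mem_unitaryGroup_iff, star_eq_conjTranspose, sqrtSwap]
  simp only [conjTranspose_add, conjTranspose_smul, conjTranspose_one, conjTranspose_permMatrix,
    Equiv.swap_inv, mul_add, add_mul, smul_mul_smul_comm, one_mul, mul_one, hP, star_div₀,
    star_add, star_sub, star_one, Complex.star_def, Complex.conj_I, Complex.conj_ofNat]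
  have h1 : (1 + Complex.I) / 2 * ((1 + -Complex.I) / 2) = 1 / 2 := by
    linear_combination (-1 / 4 : ℂ) * Complex.I_mul_I
  have h2 : (1 - Complex.I) / 2 * ((1 + -Complex.I) / 2) = -Complex.I / 2 := by
    linear_combination (1 / 4 : ℂ) * Complex.I_mul_I
  have h3 : (1 + Complex.I) / 2 * ((1 - -Complex.I) / 2) = Complex.I / 2 := by
    linear_combination (1 / 4 : ℂ) * Complex.I_mul_I
  have h4 : (1 - Complex.I) / 2 * ((1 - -Complex.I) / 2) = 1 / 2 := by
    linear_combination (-1 / 4 : ℂ) * Complex.I_mul_I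
  rw [h1, h2, h3, h4]
  module

end Unitaries

/-! ### Moments of a unitarily invariant random matrix -/

/-- The phase `i` distinguishes the multiplicities up to `3` that occur in third moments. -/
lemma I_pow_mul_ne_one {a b : ℕ} (ha : a ≤ 3) (hb : b ≤ 3) (hab : a ≠ b) :
    Complex.I ^ a * (-Complex.I) ^ b ≠ 1 := by
  have h1 : (-Complex.I : ℂ) ≠ 1 := fun h => by simpa using congrArg Complex.re h
  have h2 : (Complex.I : ℂ) ≠ 1 := fun h => by simpa using congrArg Complex.re h
  have h3 : (-1 : ℂ) ≠ 1 := by norm_num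
  interval_cases a <;> interval_cases b <;> first | exact absurd rfl hab |
    (simp [pow_succ, h1, h2, h3])

section Moments

variable {ι R : Type*} [Fintype ι] [DecidableEq ι] [CommRing R] [Algebra ℂ R]

/-- A matrix `x` over a commutative algebra `R` of "random variables" with expectation
`E : R → ℂ` is unitarily invariant if, for every unitary `V`, the substitution `x ↦ V x V†` is
induced by an endomorphism of `R` that preserves `E`. -/
def IsInvariant (E : R →ₗ[ℂ] ℂ) (x : ι → ι → R) : Prop :=
  ∀ V ∈ Matrix.unitaryGroup ι ℂ, ∃ Φ : R →ₐ[ℂ] R, (∀ r, E (Φ r) = E r) ∧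
    ∀ i j, Φ (x i j) = ∑ k, ∑ l, (V i k * star (V j l)) • x k l

variable {E : R →ₗ[ℂ] ℂ} {x : ι → ι → R}

lemma IsInvariant.exists_phase (h : IsInvariant E x) {φ : ι → ℂ}
    (hφ : ∀ i, φ i * star (φ i) = 1) :
    ∃ Φ : R →ₐ[ℂ] R, (∀ r, E (Φ r) = E r) ∧
      ∀ i j, Φ (x i j) = (φ i * star (φ j)) • x i j := by
  obtain ⟨Φ, h1, h2⟩ := h _ (diagonal_mem_unitaryGroup hφ)
  refine ⟨Φ, h1, fun i j => ?_⟩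
  rw [h2, Finset.sum_eq_single i, Finset.sum_eq_single j]
  · simp
  · intro l _ hl; simp [diagonal_apply_ne' _ hl]
  · simp
  · intro k _ hk; simp [diagonal_apply_ne' _ hk]
  · simp

lemma IsInvariant.exists_perm (h : IsInvariant E x) (σ : Equiv.Perm ι) :
    ∃ Φ : R →ₐ[ℂ] R, (∀ r, E (Φ r) = E r) ∧ ∀ i j, Φ (x i j) = x (σ i) (σ j) := by
  obtain ⟨Φ, h1, h2⟩ := h _ (permMatrix_mem_unitaryGroup σ)
  refine ⟨Φ, h1, fun i j => ?_⟩
  rw [h2, Finset.sum_eq_single (σ i), Finset.sum_eq_single (σ j)]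
  · simp [Equiv.Perm.permMatrix, PEquiv.toMatrix_apply]
  · intro l _ hl; simp [Equiv.Perm.permMatrix, PEquiv.toMatrix_apply, hl.symm]
  · simp
  · intro k _ hk; simp [Equiv.Perm.permMatrix, PEquiv.toMatrix_apply, hk.symm]
  · simp

lemma IsInvariant.exists_sqrtSwap (h : IsInvariant E x) (p q : ι) :
    ∃ Φ : R →ₐ[ℂ] R, (∀ r, E (Φ r) = E r) ∧ ∀ i j, Φ (x i j) =
      (1 / 2 : ℂ) • (x i j + x (Equiv.swap p q i) (Equiv.swap p q j)
        + Complex.I • x i (Equiv.swap p q j) - Complex.I • x (Equiv.swap p q i) j) := by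
  obtain ⟨Φ, h1, h2⟩ := h _ (sqrtSwap_mem_unitaryGroup p q)
  refine ⟨Φ, h1, fun i j => ?_⟩
  set s := Equiv.swap p q
  have e : ∀ i k, sqrtSwap p q i k = (if k = i then (1 + Complex.I) / 2 else 0) +
      (if k = s i then (1 - Complex.I) / 2 else 0) := by
    intro i k
    simp [sqrtSwap, Equiv.Perm.permMatrix, PEquiv.toMatrix_apply, one_apply, s, eq_comm]
  have e' : ∀ i k, star (sqrtSwap p q i k) = (if k = i then (1 - Complex.I) / 2 else 0) +
      (if k = s i then (1 + Complex.I) / 2 else 0) := by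
    intro i k
    rw [e, star_add]
    congr 1 <;> split_ifs <;> simp [sub_eq_add_neg]
  rw [h2]
  simp only [e']
  simp only [e, add_mul, mul_add, add_smul, Finset.sum_add_distrib, ite_mul, mul_ite,
    mul_zero, zero_mul, ite_smul, zero_smul, Finset.sum_ite_eq', Finset.mem_univ, if_true]
  have h1 : (1 + Complex.I) / 2 * ((1 + Complex.I) / 2) = Complex.I / 2 := by
    linear_combination (1 / 4 : ℂ) * Complex.I_mul_I
  have h2 : (1 - Complex.I) / 2 * ((1 + Complex.I) / 2) = 1 / 2 := by
    linear_combination (-1 / 4 : ℂ) * Complex.I_mul_I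
  have h3 : (1 + Complex.I) / 2 * ((1 - Complex.I) / 2) = 1 / 2 := by
    linear_combination (-1 / 4 : ℂ) * Complex.I_mul_I
  have h4 : (1 - Complex.I) / 2 * ((1 - Complex.I) / 2) = -Complex.I / 2 := by
    linear_combination (1 / 4 : ℂ) * Complex.I_mul_I
  rw [h1, h2, h3, h4]
  module

/-- Invariance under the diagonal unitary with entry `i` at `z` and `1` elsewhere. -/
lemma IsInvariant.exists_phase_at (h : IsInvariant E x) (z : ι) :
    ∃ Φ : R →ₐ[ℂ] R, (∀ r, E (Φ r) = E r) ∧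
      ∀ i j, Φ (x i j) = (Complex.I ^ ind z i * (-Complex.I) ^ ind z j) • x i j := by
  obtain ⟨Φ, h1, h2⟩ := h.exists_phase (φ := fun i => Complex.I ^ ind z i) (fun i => by
    unfold ind; split_ifs <;> simp)
  exact ⟨Φ, h1, fun i j => by simpa using h2 i j⟩

/-- A second moment vanishes if some index occurs with different multiplicities among the row
and the column indices. -/
lemma IsInvariant.moment_two_eq_zero (h : IsInvariant E x) (z : ι) {i₁ j₁ i₂ j₂ : ι}
    (hz : ind z i₁ + ind z i₂ ≠ ind z j₁ + ind z j₂) :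
    E (x i₁ j₁ * x i₂ j₂) = 0 := by
  obtain ⟨Φ, h1, h2⟩ := h.exists_phase_at z
  have key := h1 (x i₁ j₁ * x i₂ j₂)
  have hl : ∀ i, ind z i ≤ 1 := fun i => by unfold ind; split_ifs <;> simp
  have hne := I_pow_mul_ne_one (a := ind z i₁ + ind z i₂) (b := ind z j₁ + ind z j₂)
    (by linarith [hl i₁, hl i₂]) (by linarith [hl j₁, hl j₂]) hz
  simp only [map_mul, h2, smul_mul_smul_comm, map_smul, smul_eq_mul] at key
  by_contra h0
  refine hne (mul_right_cancel₀ h0 (Eq.trans ?_ (key.trans (one_mul _).symm)))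
  ring

/-- A third moment vanishes if some index occurs with different multiplicities among the row
and the column indices. -/
lemma IsInvariant.moment_three_eq_zero (h : IsInvariant E x) (z : ι) {i₁ j₁ i₂ j₂ i₃ j₃ : ι}
    (hz : ind z i₁ + ind z i₂ + ind z i₃ ≠ ind z j₁ + ind z j₂ + ind z j₃) :
    E (x i₁ j₁ * x i₂ j₂ * x i₃ j₃) = 0 := by
  obtain ⟨Φ, h1, h2⟩ := h.exists_phase_at z
  have key := h1 (x i₁ j₁ * x i₂ j₂ * x i₃ j₃)
  have hl : ∀ i, ind z i ≤ 1 := fun i => by unfold ind; split_ifs <;> simp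
  have hne := I_pow_mul_ne_one (a := ind z i₁ + ind z i₂ + ind z i₃)
    (b := ind z j₁ + ind z j₂ + ind z j₃)
    (by linarith [hl i₁, hl i₂, hl i₃]) (by linarith [hl j₁, hl j₂, hl j₃]) hz
  simp only [map_mul, h2, smul_mul_smul_comm, map_smul, smul_eq_mul] at key
  by_contra h0
  refine hne (mul_right_cancel₀ h0 (Eq.trans ?_ (key.trans (one_mul _).symm)))
  ring

lemma IsInvariant.moment_two_perm (h : IsInvariant E x) (σ : Equiv.Perm ι) (i₁ j₁ i₂ j₂ : ι) :
    E (x (σ i₁) (σ j₁) * x (σ i₂) (σ j₂)) = E (x i₁ j₁ * x i₂ j₂) := by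
  obtain ⟨Φ, h1, h2⟩ := h.exists_perm σ
  rw [← h1 (x i₁ j₁ * x i₂ j₂)]
  simp only [map_mul, h2]

lemma IsInvariant.moment_three_perm (h : IsInvariant E x) (σ : Equiv.Perm ι)
    (i₁ j₁ i₂ j₂ i₃ j₃ : ι) :
    E (x (σ i₁) (σ j₁) * x (σ i₂) (σ j₂) * x (σ i₃) (σ j₃)) =
      E (x i₁ j₁ * x i₂ j₂ * x i₃ j₃) := by
  obtain ⟨Φ, h1, h2⟩ := h.exists_perm σ
  rw [← h1 (x i₁ j₁ * x i₂ j₂ * x i₃ j₃)]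
  simp only [map_mul, h2]

/-- Invariance under `sqrtSwap`, in the plane spanned by two basis vectors. -/
lemma IsInvariant.moment_two_diag (h : IsInvariant E x) {p q : ι} (hpq : p ≠ q) :
    E (x p p * x p p) = E (x p p * x q q) + E (x p q * x q p) := by
  obtain ⟨Φ, h1, h2⟩ := h.exists_sqrtSwap p q
  have key := h1 (x p p * x p p)
  have sw : E (x q q * x q q) = E (x p p * x p p) := by
    simpa using h.moment_two_perm (Equiv.swap p q) p p p p
  -- the multiplicity of `p` alone detects all the vanishing terms, since only `p`, `q` occur
  have z : ∀ {i₁ j₁ i₂ j₂ : ι}, ind p i₁ + ind p i₂ ≠ ind p j₁ + ind p j₂ →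
    E (x i₁ j₁ * x i₂ j₂) = 0 := fun hz => h.moment_two_eq_zero p hz
  simp only [map_mul, h2, Equiv.swap_apply_left, mul_add, add_mul, mul_sub, sub_mul,
    smul_mul_assoc, mul_smul_comm, smul_add, smul_sub, map_add, map_sub, map_smul, smul_eq_mul,
    sw] at key
  simp only [z, ind, hpq.symm, if_true, if_false, ne_eq, add_zero, zero_add, mul_zero, sub_zero,
    mul_comm (x q q) (x p p), mul_comm (x q p) (x p q), Nat.reduceAdd, Nat.reduceEqDiff,
    not_false_eq_true, one_ne_zero, zero_ne_one] at key
  linear_combination (-2 : ℂ) * key - E (x p q * x q p) * Complex.I_mul_I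

/-- The moments supported on two indices: invariance under `sqrtSwap`, applied to the third moment
of a diagonal entry. -/
lemma IsInvariant.moment_three_diag (h : IsInvariant E x) {p q : ι} (hpq : p ≠ q) :
    E (x p p * x p p * x p p) = E (x p p * x p p * x q q) + 2 * E (x p q * x q p * x p p) := by
  obtain ⟨Φ, h1, h2⟩ := h.exists_sqrtSwap p q
  have key := h1 (x p p * x p p * x p p)
  have s1 : E (x q q * x q q * x q q) = E (x p p * x p p * x p p) := by
    simpa using h.moment_three_perm (Equiv.swap p q) p p p p p p
  have s2 : E (x q q * x q q * x p p) = E (x p p * x p p * x q q) := by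
    simpa using h.moment_three_perm (Equiv.swap p q) p p p p q q
  have s3 : E (x q p * x p q * x q q) = E (x p q * x q p * x p p) := by
    simpa using h.moment_three_perm (Equiv.swap p q) p q q p p p
  have z : ∀ {i₁ j₁ i₂ j₂ i₃ j₃ : ι},
    ind p i₁ + ind p i₂ + ind p i₃ ≠ ind p j₁ + ind p j₂ + ind p j₃ →
    E (x i₁ j₁ * x i₂ j₂ * x i₃ j₃) = 0 := fun hz => h.moment_three_eq_zero p hz
  simp only [map_mul, h2, Equiv.swap_apply_left, mul_add, add_mul, mul_sub, sub_mul,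
    smul_mul_assoc, mul_smul_comm, smul_add, smul_sub, map_add, map_sub, map_smul, smul_eq_mul]
    at key
  simp only [z, ind, hpq.symm, if_true, if_false, ne_eq, add_zero, zero_add, mul_zero, sub_zero,
    Nat.reduceAdd, Nat.reduceEqDiff, not_false_eq_true, one_ne_zero, zero_ne_one] at key
  simp only [mul_comm, mul_left_comm] at key s1 s2 s3 ⊢
  simp only [s1, s2, s3] at key
  linear_combination (-4 / 3 : ℂ) * key - 2 * E (x p p * (x p q * x q p)) * Complex.I_mul_I

/-- Invariance under `sqrtSwap p q`, which fixes `x r r`. -/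
lemma IsInvariant.moment_three_diag_fixed (h : IsInvariant E x) {p q r : ι} (hpq : p ≠ q)
    (hpr : p ≠ r) (hqr : q ≠ r) :
    E (x p p * x p p * x r r) = E (x p p * x q q * x r r) + E (x p q * x q p * x r r) := by
  obtain ⟨Φ, h1, h2⟩ := h.exists_sqrtSwap p q
  have key := h1 (x p p * x p p * x r r)
  have hr : Equiv.swap p q r = r := Equiv.swap_apply_of_ne_of_ne hpr.symm hqr.symm
  have hΦ : Φ (x r r) = x r r := by rw [h2, hr]; module
  have s1 : E (x q q * x q q * x r r) = E (x p p * x p p * x r r) := by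
    simpa [hr] using h.moment_three_perm (Equiv.swap p q) p p p p r r
  have z : ∀ {i₁ j₁ i₂ j₂ i₃ j₃ : ι},
    ind p i₁ + ind p i₂ + ind p i₃ ≠ ind p j₁ + ind p j₂ + ind p j₃ →
    E (x i₁ j₁ * x i₂ j₂ * x i₃ j₃) = 0 := fun hz => h.moment_three_eq_zero p hz
  simp only [map_mul, hΦ] at key
  simp only [h2, Equiv.swap_apply_left, mul_add, add_mul, mul_sub, sub_mul,
    smul_mul_assoc, mul_smul_comm, smul_add, smul_sub, map_add, map_sub, map_smul, smul_eq_mul]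
    at key
  simp only [z, ind, hpq.symm, hpr.symm, if_true, if_false, ne_eq, add_zero, zero_add, mul_zero,
    sub_zero, Nat.reduceAdd, Nat.reduceEqDiff, not_false_eq_true, one_ne_zero, zero_ne_one] at key
  simp only [mul_comm, mul_left_comm] at key s1 ⊢
  simp only [s1] at key
  linear_combination (-2 : ℂ) * key - E (x p q * (x q p * x r r)) * Complex.I_mul_I

/-- Invariance under `sqrtSwap p q`, which fixes the index `r` and mixes `x p r` with `x q r`. -/
lemma IsInvariant.moment_three_cross (h : IsInvariant E x) {p q r : ι} (hpq : p ≠ q)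
    (hpr : p ≠ r) (hqr : q ≠ r) :
    E (x p r * x r p * x p p) = E (x p r * x r p * x q q) + E (x p q * x q r * x r p) := by
  obtain ⟨Φ, h1, h2⟩ := h.exists_sqrtSwap p q
  have key := h1 (x p r * x r p * x p p)
  have hr : Equiv.swap p q r = r := Equiv.swap_apply_of_ne_of_ne hpr.symm hqr.symm
  have s1 : E (x q r * x r q * x q q) = E (x p r * x r p * x p p) := by
    simpa [hr] using h.moment_three_perm (Equiv.swap p q) p r r p p p
  have s2 : E (x q r * x r q * x p p) = E (x p r * x r p * x q q) := by
    simpa [hr] using h.moment_three_perm (Equiv.swap p q) p r r p q q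
  have s3 : E (x q p * x p r * x r q) = E (x p q * x q r * x r p) := by
    simpa [hr] using h.moment_three_perm (Equiv.swap p q) p q q r r p
  have z : ∀ {i₁ j₁ i₂ j₂ i₃ j₃ : ι},
    ind p i₁ + ind p i₂ + ind p i₃ ≠ ind p j₁ + ind p j₂ + ind p j₃ →
    E (x i₁ j₁ * x i₂ j₂ * x i₃ j₃) = 0 := fun hz => h.moment_three_eq_zero p hz
  simp only [map_mul, h2, hr, Equiv.swap_apply_left, mul_add, add_mul, mul_sub, sub_mul,
    smul_mul_assoc, mul_smul_comm, smul_add, smul_sub, map_add, map_sub, map_smul, smul_eq_mul]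
    at key
  simp only [z, ind, hpq.symm, hpr.symm, if_true, if_false, ne_eq, add_zero, zero_add, mul_zero,
    sub_zero, Nat.reduceAdd, Nat.reduceEqDiff, not_false_eq_true, one_ne_zero, zero_ne_one] at key
  simp only [mul_comm, mul_left_comm] at key s1 s2 s3 ⊢
  simp only [s1, s2, s3] at key
  linear_combination (-2 : ℂ) * key - (E (x p p * (x p r * x r p)) / 2
    + E (x p r * (x q q * x r p)) / 2 + E (x p q * (x q r * x r p))) * Complex.I_mul_I

/-- The second moments of a unitarily invariant random matrix are a combination of the matrix
entries of the two permutation operators on the tensor square. -/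
theorem IsInvariant.exists_moment_two (h : IsInvariant E x) (hι : 1 < Fintype.card ι) :
    ∃ c₁ c₂ : ℂ, ∀ i₁ j₁ i₂ j₂ : ι, E (x i₁ j₁ * x i₂ j₂) =
      c₁ * (dl i₁ j₁ * dl i₂ j₂) + c₂ * (dl i₁ j₂ * dl i₂ j₁) := by
  obtain ⟨a, b, hab⟩ := Fintype.one_lt_card_iff.mp hι
  refine ⟨E (x a a * x b b), E (x a b * x b a), ?_⟩
  set c₁ := E (x a a * x b b)
  set c₂ := E (x a b * x b a)
  have t1 : ∀ {p q : ι}, p ≠ q → E (x p p * x q q) = c₁ := by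
    intro p q hpq
    obtain ⟨σ, rfl, rfl⟩ := exists_perm_two hab hpq
    exact h.moment_two_perm σ a a b b
  have t2 : ∀ {p q : ι}, p ≠ q → E (x p q * x q p) = c₂ := by
    intro p q hpq
    obtain ⟨σ, rfl, rfl⟩ := exists_perm_two hab hpq
    exact h.moment_two_perm σ a b b a
  have u : ∀ p, E (x p p * x p p) = c₁ + c₂ := by
    intro p
    obtain ⟨q, hq⟩ := Fintype.exists_ne_of_one_lt_card hι p
    rw [h.moment_two_diag hq.symm, t1 hq.symm, t2 hq.symm]
  intro i₁ j₁ i₂ j₂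
  by_cases hz : ∀ z, ind z i₁ + ind z i₂ = ind z j₁ + ind z j₂
  · rcases eq_perm_of_ind_add_eq hz with ⟨rfl, rfl⟩ | ⟨rfl, rfl⟩ <;> by_cases h12 : j₁ = j₂
    · subst h12; simp [u, dl]
    · simp [t1 h12, dl, h12]
    · subst h12; simp [u, dl]
    · simp [t2 (Ne.symm h12), dl, h12, Ne.symm h12]
  · push Not at hz
    obtain ⟨z, hz⟩ := hz
    rw [h.moment_two_eq_zero z hz]
    rw [dl_mul_dl_eq_zero, dl_mul_dl_eq_zero]
    · ring
    all_goals rintro ⟨rfl, rfl⟩; exact hz (by ring)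

/-- The third moments of a unitarily invariant random matrix are a combination of the matrix
entries of the six permutation operators on the tensor cube, with coefficients that depend only
on the conjugacy class. -/
theorem IsInvariant.exists_moment_three (h : IsInvariant E x) (hι : 2 < Fintype.card ι) :
    ∃ c₁ c₂ c₃ : ℂ, ∀ i₁ j₁ i₂ j₂ i₃ j₃ : ι, E (x i₁ j₁ * x i₂ j₂ * x i₃ j₃) =
      c₁ * (dl i₁ j₁ * dl i₂ j₂ * dl i₃ j₃) +
      c₂ * (dl i₁ j₁ * dl i₂ j₃ * dl i₃ j₂ + dl i₁ j₃ * dl i₂ j₂ * dl i₃ j₁ +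
        dl i₁ j₂ * dl i₂ j₁ * dl i₃ j₃) +
      c₃ * (dl i₁ j₂ * dl i₂ j₃ * dl i₃ j₁ + dl i₁ j₃ * dl i₂ j₁ * dl i₃ j₂) := by
  obtain ⟨a, b, c, hab, hac, hbc⟩ := Fintype.two_lt_card_iff.mp hι
  refine ⟨E (x a a * x b b * x c c), E (x a b * x b a * x c c), E (x a b * x b c * x c a), ?_⟩
  set c₁ := E (x a a * x b b * x c c)
  set c₂ := E (x a b * x b a * x c c)
  set c₃ := E (x a b * x b c * x c a)
  have t1 : ∀ {p q r : ι}, p ≠ q → p ≠ r → q ≠ r → E (x p p * x q q * x r r) = c₁ := by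
    intro p q r hpq hpr hqr
    obtain ⟨σ, rfl, rfl, rfl⟩ := exists_perm_three hab hac hbc hpq hpr hqr
    exact h.moment_three_perm σ a a b b c c
  have t2 : ∀ {p q r : ι}, p ≠ q → p ≠ r → q ≠ r → E (x p q * x q p * x r r) = c₂ := by
    intro p q r hpq hpr hqr
    obtain ⟨σ, rfl, rfl, rfl⟩ := exists_perm_three hab hac hbc hpq hpr hqr
    exact h.moment_three_perm σ a b b a c c
  have t3 : ∀ {p q r : ι}, p ≠ q → p ≠ r → q ≠ r → E (x p q * x q r * x r p) = c₃ := by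
    intro p q r hpq hpr hqr
    obtain ⟨σ, rfl, rfl, rfl⟩ := exists_perm_three hab hac hbc hpq hpr hqr
    exact h.moment_three_perm σ a b b c c a
  have third : ∀ p q : ι, ∃ r, p ≠ r ∧ q ≠ r := by
    intro p q
    obtain ⟨r, -, hr⟩ := Finset.exists_mem_notMem_of_card_lt_card (s := {p, q})
      (t := Finset.univ) (Finset.card_le_two.trans_lt hι)
    simp only [Finset.mem_insert, Finset.mem_singleton, not_or] at hr
    exact ⟨r, Ne.symm hr.1, Ne.symm hr.2⟩
  have u1 : ∀ {p q : ι}, p ≠ q → E (x p p * x p p * x q q) = c₁ + c₂ := by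
    intro p q hpq
    obtain ⟨r, hpr, hqr⟩ := third p q
    rw [h.moment_three_diag_fixed hpr hpq hqr.symm, t1 hpr hpq hqr.symm, t2 hpr hpq hqr.symm]
  have u2 : ∀ {p q : ι}, p ≠ q → E (x p q * x q p * x p p) = c₂ + c₃ := by
    intro p q hpq
    obtain ⟨r, hpr, hqr⟩ := third p q
    rw [h.moment_three_cross hpr hpq hqr.symm, t2 hpq hpr hqr, t3 hpr hpq hqr.symm]
  have u3 : ∀ p, E (x p p * x p p * x p p) = c₁ + 3 * c₂ + 2 * c₃ := by
    intro p
    obtain ⟨q, hpq, -⟩ := third p p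
    rw [h.moment_three_diag hpq, u1 hpq, u2 hpq]
    ring
  -- `f1`, `f2`, `f3`: one moment for each conjugacy class of pairings, with any coincidences among
  -- the indices; the other pairings arise by reordering the three factors
  have f1 : ∀ p q r, E (x p p * x q q * x r r) =
      c₁ + c₂ * (dl p q + dl p r + dl q r) + 2 * c₃ * (dl p q * dl q r) := by
    intro p q r
    by_cases hpq : p = q
    · subst hpq
      by_cases hpr : p = r
      · subst hpr; rw [u3]; simp [dl]; ring
      · rw [u1 hpr]; simp [dl, hpr]
    · by_cases hpr : p = r
      · subst hpr
        rw [mul_right_comm, u1 hpq]; simp [dl, hpq, Ne.symm hpq]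
      · by_cases hqr : q = r
        · subst hqr
          rw [mul_assoc, mul_comm, u1 (Ne.symm hpq)]; simp [dl, hpq]
        · rw [t1 hpq hpr hqr]; simp [dl, hpq, hpr, hqr]
  have f2 : ∀ p q r, E (x p q * x q p * x r r) =
      c₁ * dl p q + c₂ * (1 + 2 * (dl p q * dl q r)) + c₃ * (dl p r + dl q r) := by
    intro p q r
    by_cases hpq : p = q
    · subst hpq
      rw [f1]
      simp [dl]; split_ifs <;> ring
    · by_cases hpr : p = r
      · subst hpr
        rw [u2 hpq]; simp [dl, hpq, Ne.symm hpq]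
      · by_cases hqr : q = r
        · subst hqr
          rw [mul_comm (x p q), u2 (Ne.symm hpq)]; simp [dl, hpq]
        · rw [t2 hpq hpr hqr]; simp [dl, hpq, hpr, hqr]
  have f3 : ∀ p q r, E (x p q * x q r * x r p) =
      c₁ * (dl p q * dl q r) + c₂ * (dl p q + dl q r + dl p r) + c₃ * (1 + dl p q * dl q r) := by
    intro p q r
    by_cases hpq : p = q
    · subst hpq
      rw [mul_assoc, mul_comm, f2]
      simp only [dl, @eq_comm _ r p]; split_ifs <;> ring
    · by_cases hpr : p = r
      · subst hpr
        rw [f2]; simp [dl, hpq, Ne.symm hpq]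
      · by_cases hqr : q = r
        · subst hqr
          rw [mul_right_comm, f2]; simp [dl, hpq]
        · rw [t3 hpq hpr hqr]; simp [dl, hpq, hpr, hqr]
  have dd : ∀ p q r : ι, dl p q * dl q r * dl p r = dl p q * dl q r := by
    intro p q r; simp only [dl]; split_ifs <;> simp_all
  have d2 : ∀ p q : ι, dl p q * dl p q = dl p q := by
    intro p q; simp only [dl]; split_ifs <;> simp
  intro i₁ j₁ i₂ j₂ i₃ j₃
  by_cases hz : ∀ z, ind z i₁ + ind z i₂ + ind z i₃ = ind z j₁ + ind z j₂ + ind z j₃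
  · rcases eq_perm_of_ind_add_add_eq hz with ⟨rfl, rfl, rfl⟩ | ⟨rfl, rfl, rfl⟩ |
      ⟨rfl, rfl, rfl⟩ | ⟨rfl, rfl, rfl⟩ | ⟨rfl, rfl, rfl⟩ | ⟨rfl, rfl, rfl⟩
    · rw [f1]; simp only [dl_self]; grind [dl_comm]
    · rw [mul_assoc, mul_comm, f2]; simp only [dl_self]; grind [dl_comm]
    · rw [mul_right_comm, f2]; simp only [dl_self]; grind [dl_comm]
    · rw [f2]; simp only [dl_self]; grind [dl_comm]
    · rw [f3]; simp only [dl_self]; grind [dl_comm]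
    · rw [mul_right_comm, f3]; simp only [dl_self]; grind [dl_comm]
  · push Not at hz
    obtain ⟨z, hz⟩ := hz
    rw [h.moment_three_eq_zero z hz]
    rw [dl_mul_dl_mul_dl_eq_zero, dl_mul_dl_mul_dl_eq_zero, dl_mul_dl_mul_dl_eq_zero,
      dl_mul_dl_mul_dl_eq_zero, dl_mul_dl_mul_dl_eq_zero, dl_mul_dl_mul_dl_eq_zero]
    · ring
    all_goals rintro ⟨rfl, rfl, rfl⟩; exact hz (by ring)

end Moments

/-! ### Averaged purity and third moment of the marginal -/

section Contraction

variable {A B R : Type*} [Fintype A] [DecidableEq A] [Fintype B] [DecidableEq B] [CommRing R]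
  [Algebra ℂ R] {E : R →ₗ[ℂ] ℂ} {x : A × B → A × B → R}

/-- The averaged purity of the partial trace of a unitarily invariant random matrix of trace one,
in terms of its total dimension and averaged purity. -/
theorem IsInvariant.expect_marginal_sq (h : IsInvariant E x) (hE : E 1 = 1)
    (hx : ∑ i, x i i = 1) (hd : 1 < Fintype.card (A × B)) {dA dB d p : ℂ}
    (hdA : dA = Fintype.card A) (hdB : dB = Fintype.card B) (hd' : d = dA * dB)
    (hp : E (∑ i, ∑ j, x i j * x j i) = p) :
    (d ^ 2 - 1) * E (∑ a, ∑ b, (∑ k, x (a, k) (b, k)) * ∑ l, x (b, l) (a, l)) =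
      (d - p) * dB + (d * p - 1) * dA := by
  obtain ⟨c₁, c₂, hc⟩ := h.exists_moment_two hd
  have e1 : c₁ * d ^ 2 + c₂ * d = 1 := by
    have h1 : (1 : R) = (∑ i, x i i) * ∑ i, x i i := by rw [hx]; ring
    rw [← hE, h1]
    simp [Finset.sum_mul_sum, map_sum, hc, dl,
      Finset.sum_add_distrib, ← hdA, ← hdB, hd']
    ring
  have e2 : c₁ * d + c₂ * d ^ 2 = p := by
    rw [← hp]
    simp [map_sum, hc, dl,
      Finset.sum_add_distrib, ← hdA, ← hdB, hd']
    ring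
  have e3 : E (∑ a, ∑ b, (∑ k, x (a, k) (b, k)) * ∑ l, x (b, l) (a, l)) =
      c₁ * dA * dB ^ 2 + c₂ * dA ^ 2 * dB := by
    simp [Finset.sum_mul_sum, map_sum, hc, dl,
      Finset.sum_add_distrib, ← hdA, ← hdB]
    ring
  rw [e3]
  subst hd'
  linear_combination dB * (dA * dB * e1 - e2) + dA * (dA * dB * e2 - e1)

/-- The averaged third moment of the partial trace of a unitarily invariant random matrix of trace
one. -/
theorem IsInvariant.expect_marginal_cube (h : IsInvariant E x) (hE : E 1 = 1)
    (hx : ∑ i, x i i = 1) (hd : 2 < Fintype.card (A × B)) {dA dB d p q : ℂ}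
    (hdA : dA = Fintype.card A) (hdB : dB = Fintype.card B) (hd' : d = dA * dB)
    (hp : E (∑ i, ∑ j, x i j * x j i) = p)
    (hq : E (∑ i, ∑ j, ∑ k, x i j * x j k * x k i) = q) :
    (d ^ 2 - 1) * (d ^ 2 - 4) * E (∑ a, ∑ b, ∑ c, (∑ k, x (a, k) (b, k)) *
        (∑ l, x (b, l) (c, l)) * ∑ m, x (c, m) (a, m)) =
      dB ^ 2 * (d ^ 2 - 2 - 3 * d * p + 4 * q) + 3 * d * (-d + (d ^ 2 + 2) * p - 2 * d * q) +
        (dA ^ 2 + 1) * (2 - 3 * d * p + d ^ 2 * q) := by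
  obtain ⟨c₁, c₂, c₃, hc⟩ := h.exists_moment_three hd
  have e1 : c₁ * d ^ 3 + 3 * c₂ * d ^ 2 + 2 * c₃ * d = 1 := by
    have h1 : (1 : R) = (∑ i, x i i) * (∑ i, x i i) * ∑ i, x i i := by rw [hx]; ring
    rw [← hE, h1]
    simp [Finset.sum_mul, Finset.mul_sum, map_sum, hc, dl, mul_add,
      Finset.sum_add_distrib, ← hdA, ← hdB, hd']
    ring
  have e2 : c₁ * d ^ 2 + c₂ * (d ^ 3 + 2 * d) + 2 * c₃ * d ^ 2 = p := by
    rw [← hp, ← mul_one (∑ i, ∑ j, x i j * x j i), ← hx]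
    simp [Finset.sum_mul, Finset.mul_sum, map_sum, hc, dl, mul_add,
      Finset.sum_add_distrib, ← hdA, ← hdB, hd']
    ring
  have e3 : c₁ * d + 3 * c₂ * d ^ 2 + c₃ * (d ^ 3 + d) = q := by
    rw [← hq]
    simp [map_sum, hc, dl, mul_add,
      Finset.sum_add_distrib, ← hdA, ← hdB, hd']
    ring
  have e4 : E (∑ a, ∑ b, ∑ c, (∑ k, x (a, k) (b, k)) *
        (∑ l, x (b, l) (c, l)) * ∑ m, x (c, m) (a, m)) =
      c₁ * dA * dB ^ 3 + 3 * c₂ * dA ^ 2 * dB ^ 2 + c₃ * (dA ^ 3 * dB + dA * dB) := by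
    simp [ite_and, Finset.sum_ite_irrel, Finset.sum_mul, Finset.mul_sum, map_sum, hc, dl, mul_add,
      Finset.sum_add_distrib, ← hdA, ← hdB]
    ring
  rw [e4]
  -- the multipliers of `e1`, `e2`, `e3` are the entries of the inverse of the linear system for
  -- `c₁`, `c₂`, `c₃`, up to the common denominator `d (d² - 1) (d² - 4)`
  subst hd'
  linear_combination dB ^ 2 * (((dA * dB) ^ 2 - 2) * e1 - 3 * (dA * dB) * e2 + 4 * e3) +
    3 * (dA * dB) * (-(dA * dB) * e1 + ((dA * dB) ^ 2 + 2) * e2 - 2 * (dA * dB) * e3) +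
    (dA ^ 2 + 1) * (2 * e1 - 3 * (dA * dB) * e2 + (dA * dB) ^ 2 * e3)

end Contraction

/-! ### Haar expectation on the unitary group -/

section Haar

variable {ι : Type*} [Fintype ι] [DecidableEq ι]

instance isProbabilityMeasure_haarU : IsProbabilityMeasure (haarU ι) :=
  ⟨Measure.haarMeasure_self⟩

instance isMulLeftInvariant_haarU : (haarU ι).IsMulLeftInvariant := by
  unfold haarU; infer_instance

lemma integrable_haarU_of_continuous {F : Type*} [NormedAddCommGroup F]
    [SecondCountableTopology F] {f : Matrix.unitaryGroup ι ℂ → F} (hf : Continuous f) :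
    Integrable f (haarU ι) :=
  hf.integrable_of_hasCompactSupport (HasCompactSupport.of_compactSpace f)

/-- Integration against the Haar probability measure, as a linear functional on the algebra of
continuous functions. -/
noncomputable def expect (ι : Type*) [Fintype ι] [DecidableEq ι] :
    C(Matrix.unitaryGroup ι ℂ, ℂ) →ₗ[ℂ] ℂ where
  toFun f := ∫ U, f U ∂(haarU ι)
  map_add' f g := integral_add (integrable_haarU_of_continuous f.continuous)
    (integrable_haarU_of_continuous g.continuous)
  map_smul' c _ := integral_smul c _

lemma expect_apply (f : C(Matrix.unitaryGroup ι ℂ, ℂ)) : expect ι f = ∫ U, f U ∂(haarU ι) := rfl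

lemma expect_const {f : C(Matrix.unitaryGroup ι ℂ, ℂ)} {c : ℂ} (hf : ∀ U, f U = c) :
    expect ι f = c := by
  simp [expect_apply, hf]

lemma continuous_orbit (ρ : Matrix ι ι ℂ) : Continuous fun U : Matrix.unitaryGroup ι ℂ =>
    (U : Matrix ι ι ℂ) * ρ * (U : Matrix ι ι ℂ)ᴴ :=
  (continuous_subtype_val.matrix_mul continuous_const).matrix_mul
    continuous_subtype_val.matrix_conjTranspose

/-- The entries of `U ρ U†` as continuous functions of `U`. -/
def orbitEntry (ρ : Matrix ι ι ℂ) (i j : ι) : C(Matrix.unitaryGroup ι ℂ, ℂ) :=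
  ⟨fun U => ((U : Matrix ι ι ℂ) * ρ * (U : Matrix ι ι ℂ)ᴴ) i j,
    (continuous_orbit ρ).matrix_elem i j⟩

lemma orbitEntry_apply (ρ : Matrix ι ι ℂ) (i j : ι) (U : Matrix.unitaryGroup ι ℂ) :
    orbitEntry ρ i j U = ((U : Matrix ι ι ℂ) * ρ * (U : Matrix ι ι ℂ)ᴴ) i j := rfl

lemma isInvariant_orbitEntry (ρ : Matrix ι ι ℂ) : IsInvariant (expect ι) (orbitEntry ρ) := by
  intro V hV
  refine ⟨ContinuousMap.compRightAlgHom ℂ ℂ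
    ⟨fun U => (⟨V, hV⟩ : Matrix.unitaryGroup ι ℂ) * U, continuous_const_mul _⟩, fun f => ?_,
    fun i j => ?_⟩
  · exact integral_mul_left_eq_self (μ := haarU ι) (fun U => f U) ⟨V, hV⟩
  · ext U
    have e : (V * (U : Matrix ι ι ℂ)) * ρ * (V * (U : Matrix ι ι ℂ))ᴴ =
        V * ((U : Matrix ι ι ℂ) * ρ * (U : Matrix ι ι ℂ)ᴴ) * Vᴴ := by
      rw [conjTranspose_mul]; simp only [Matrix.mul_assoc]
    change ((V * (U : Matrix ι ι ℂ)) * ρ * (V * (U : Matrix ι ι ℂ))ᴴ) i j = _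
    rw [e, mul_apply]
    simp only [ContinuousMap.coe_sum, Finset.sum_apply, ContinuousMap.coe_smul, Pi.smul_apply,
      orbitEntry_apply, smul_eq_mul, conjTranspose_apply]
    rw [Finset.sum_comm]
    refine Finset.sum_congr rfl fun l _ => ?_
    rw [mul_apply, Finset.sum_mul]
    refine Finset.sum_congr rfl fun k _ => ?_
    ring

lemma unitary_conj_pow (ρ : Matrix ι ι ℂ) (U : Matrix.unitaryGroup ι ℂ) (k : ℕ) :
    ((U : Matrix ι ι ℂ) * ρ * (U : Matrix ι ι ℂ)ᴴ) ^ k =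
      (U : Matrix ι ι ℂ) * ρ ^ k * (U : Matrix ι ι ℂ)ᴴ := by
  have hU : (U : Matrix ι ι ℂ) * (U : Matrix ι ι ℂ)ᴴ = 1 := mem_unitaryGroup_iff.mp U.2
  have hU' : (U : Matrix ι ι ℂ)ᴴ * (U : Matrix ι ι ℂ) = 1 := mem_unitaryGroup_iff'.mp U.2
  induction k with
  | zero => simp [hU]
  | succ k ih =>
    rw [pow_succ, ih, pow_succ]
    simp only [Matrix.mul_assoc]
    rw [← Matrix.mul_assoc _ᴴ (U : Matrix ι ι ℂ), hU', Matrix.one_mul]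

lemma trace_unitary_conj (ρ : Matrix ι ι ℂ) (U : Matrix.unitaryGroup ι ℂ) :
    ((U : Matrix ι ι ℂ) * ρ * (U : Matrix ι ι ℂ)ᴴ).trace = ρ.trace := by
  have hU' : (U : Matrix ι ι ℂ)ᴴ * (U : Matrix ι ι ℂ) = 1 := mem_unitaryGroup_iff'.mp U.2
  rw [trace_mul_comm, ← Matrix.mul_assoc, hU', Matrix.one_mul]

lemma trace_sq (X : Matrix ι ι ℂ) : (X ^ 2).trace = ∑ i, ∑ j, X i j * X j i := by
  simp [pow_two, trace, mul_apply]

lemma trace_cube (X : Matrix ι ι ℂ) :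
    (X ^ 3).trace = ∑ i, ∑ j, ∑ k, X i j * X j k * X k i := by
  simp only [pow_succ, pow_zero, Matrix.one_mul, trace, diag_apply, mul_apply, Finset.sum_mul]
  exact Finset.sum_congr rfl fun i _ => Finset.sum_comm

lemma _root_.Matrix.IsHermitian.trace_pow_eq_ofReal {ρ : Matrix ι ι ℂ} (hρ : ρ.IsHermitian)
    (k : ℕ) : (ρ ^ k).trace = (trPow ρ k : ℂ) := by
  have h : star (ρ ^ k).trace = (ρ ^ k).trace := by
    rw [← trace_conjTranspose, (hρ.pow k).eq]
  exact (Complex.conj_eq_iff_re.mp h).symm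

end Haar

section Bipartite

variable {A B : Type*} [Fintype A] [DecidableEq A] [Fintype B] [DecidableEq B]
variable {ρ : Matrix (A × B) (A × B) ℂ}

lemma marginal_apply (U : Matrix.unitaryGroup (A × B) ℂ) (a b : A) :
    marginal ρ U a b = ∑ k, orbitEntry ρ (a, k) (b, k) U := rfl

lemma continuous_marginal (ρ : Matrix (A × B) (A × B) ℂ) : Continuous (marginal ρ) :=
  continuous_matrix fun a b => by
    simp only [marginal_apply]
    exact continuous_finsetSum _ fun k _ => (orbitEntry ρ (a, k) (b, k)).continuous

lemma sum_orbitEntry (hρ : IsDensity ρ) : ∑ i, orbitEntry ρ i i = 1 := by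
  ext U
  have h := (trace_unitary_conj ρ U).trans hρ.2
  simpa [orbitEntry_apply, trace] using h

lemma expect_orbit_sq (hρ : IsDensity ρ) :
    expect (A × B) (∑ i, ∑ j, orbitEntry ρ i j * orbitEntry ρ j i) = trPow ρ 2 := by
  refine expect_const fun U => ?_
  rw [← hρ.1.1.trace_pow_eq_ofReal, ← trace_unitary_conj (ρ ^ 2) U, ← unitary_conj_pow, trace_sq]
  simp [orbitEntry_apply]

lemma expect_orbit_cube (hρ : IsDensity ρ) :
    expect (A × B) (∑ i, ∑ j, ∑ k, orbitEntry ρ i j * orbitEntry ρ j k * orbitEntry ρ k i) =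
      trPow ρ 3 := by
  refine expect_const fun U => ?_
  rw [← hρ.1.1.trace_pow_eq_ofReal, ← trace_unitary_conj (ρ ^ 3) U, ← unitary_conj_pow, trace_cube]
  simp [orbitEntry_apply]

/-- The Haar average of the purity of the marginal. -/
theorem integral_trace_marginal_sq (hρ : IsDensity ρ) {dA dB d : ℂ} (hdA : dA = Fintype.card A)
    (hdB : dB = Fintype.card B) (hd : d = dA * dB) (hcard : 1 < Fintype.card (A × B)) :
    (d ^ 2 - 1) * ∫ U, (marginal ρ U ^ 2).trace ∂(haarU (A × B)) =
      (d - trPow ρ 2) * dB + (d * trPow ρ 2 - 1) * dA := by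
  rw [← (isInvariant_orbitEntry ρ).expect_marginal_sq (expect_const fun _ => rfl)
    (sum_orbitEntry hρ) hcard hdA hdB hd (expect_orbit_sq hρ), expect_apply]
  simp [trace_sq, marginal_apply]

/-- The Haar average of the third moment of the marginal. -/
theorem integral_trace_marginal_cube (hρ : IsDensity ρ) {dA dB d : ℂ}
    (hdA : dA = Fintype.card A) (hdB : dB = Fintype.card B) (hd : d = dA * dB)
    (hcard : 2 < Fintype.card (A × B)) :
    (d ^ 2 - 1) * (d ^ 2 - 4) * ∫ U, (marginal ρ U ^ 3).trace ∂(haarU (A × B)) =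
      dB ^ 2 * (d ^ 2 - 2 - 3 * d * trPow ρ 2 + 4 * trPow ρ 3) +
        3 * d * (-d + (d ^ 2 + 2) * trPow ρ 2 - 2 * d * trPow ρ 3) +
        (dA ^ 2 + 1) * (2 - 3 * d * trPow ρ 2 + d ^ 2 * trPow ρ 3) := by
  rw [← (isInvariant_orbitEntry ρ).expect_marginal_cube (expect_const fun _ => rfl)
    (sum_orbitEntry hρ) hcard hdA hdB hd (expect_orbit_sq hρ) (expect_orbit_cube hρ), expect_apply]
  simp [trace_cube, marginal_apply]

end Bipartite

/-! ### Spectral expressions for density matrices -/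

section Spectral

variable {A : Type*} [Fintype A] [DecidableEq A] {R : Matrix A A ℂ}

lemma _root_.Matrix.IsHermitian.trace_cfc (hR : R.IsHermitian) (f : ℝ → ℝ) :
    (cfc f R).trace = ((∑ i, f (hR.eigenvalues i) : ℝ) : ℂ) := by
  rw [hR.cfc_eq, Matrix.IsHermitian.cfc, Unitary.conjStarAlgAut_apply, trace_mul_cycle,
    Unitary.coe_star_mul_self, Matrix.one_mul]
  simp [trace]

lemma continuousOn_spectrum_real (R : Matrix A A ℂ) (f : ℝ → ℝ) :
    ContinuousOn f (spectrum ℝ R) := (Matrix.finite_real_spectrum (A := R)).continuousOn f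

lemma _root_.Matrix.IsHermitian.trace_mul_one_sub_pow (hR : R.IsHermitian) (n : ℕ) :
    (R * (1 - R) ^ n).trace =
      ((∑ i, hR.eigenvalues i * (1 - hR.eigenvalues i) ^ n : ℝ) : ℂ) := by
  have ha : IsSelfAdjoint R := hR
  have e : R * (1 - R) ^ n = cfc (fun t : ℝ => t * (1 - t) ^ n) R := by
    rw [cfc_mul (fun t : ℝ => t) (fun t => (1 - t) ^ n) R, cfc_pow (fun t : ℝ => 1 - t) n R,
      cfc_sub (fun _ : ℝ => 1) (fun t => t) R, cfc_const_one ℝ R, cfc_id' ℝ R]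
  rw [e, hR.trace_cfc]

lemma entropy_eq_sum_negMulLog (hR : R.IsHermitian) :
    entropy R = ∑ i, Real.negMulLog (hR.eigenvalues i) := by
  have ha : IsSelfAdjoint R := hR
  have e : R * cfc Real.log R = cfc (fun t : ℝ => t * Real.log t) R := by
    rw [cfc_mul (fun t : ℝ => t) Real.log R (by fun_prop)
      (continuousOn_spectrum_real R _), cfc_id' ℝ R]
  rw [entropy, e, hR.trace_cfc, Complex.ofReal_re]
  simp [Real.negMulLog]

lemma IsDensity.sum_eigenvalues (hR : IsDensity R) : ∑ i, hR.1.1.eigenvalues i = 1 := by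
  have h := hR.1.1.trace_eq_sum_eigenvalues.symm.trans hR.2
  apply Complex.ofReal_injective
  simpa using h

lemma IsDensity.eigenvalues_le_one (hR : IsDensity R) (i : A) : hR.1.1.eigenvalues i ≤ 1 := by
  rw [← hR.sum_eigenvalues]
  exact Finset.single_le_sum (fun j _ => hR.1.eigenvalues_nonneg j) (Finset.mem_univ i)

/-- The expansion `-t ln t = ∑ t (1 - t)ᵏ / k` holds on all of `[0, 1]`, including `t = 0`, where
every term vanishes. -/
lemma hasSum_negMulLog {t : ℝ} (h0 : 0 ≤ t) (h1 : t ≤ 1) :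
    HasSum (fun k : ℕ => t * (1 - t) ^ (k + 1) / ((k + 1 : ℕ) : ℝ)) (Real.negMulLog t) := by
  rcases h0.eq_or_lt with rfl | h0
  · simp
  · have h := (Real.hasSum_pow_div_log_of_abs_lt_one (x := 1 - t)
      (by rw [abs_lt]; constructor <;> linarith)).mul_left t
    convert! h using 1
    · ext k; push_cast; ring
    · rw [sub_sub_cancel, Real.negMulLog]; ring

/-- The moment `Tr [R (1 - R)ⁿ]` as a real number; the trace is real when `R` is Hermitian. -/
noncomputable def moment (R : Matrix A A ℂ) (n : ℕ) : ℝ := ((R * (1 - R) ^ n).trace).re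

lemma moment_eq_sum (hR : R.IsHermitian) (n : ℕ) :
    moment R n = ∑ i, hR.eigenvalues i * (1 - hR.eigenvalues i) ^ n := by
  rw [moment, hR.trace_mul_one_sub_pow, Complex.ofReal_re]

lemma ofReal_moment (hR : R.IsHermitian) (n : ℕ) :
    (moment R n : ℂ) = (R * (1 - R) ^ n).trace := by
  rw [moment_eq_sum hR, hR.trace_mul_one_sub_pow]

lemma continuous_moment (n : ℕ) : Continuous fun R : Matrix A A ℂ => moment R n := by
  unfold moment
  fun_prop

lemma IsDensity.moment_nonneg (hR : IsDensity R) (n : ℕ) : 0 ≤ moment R n := by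
  rw [moment_eq_sum hR.1.1]
  exact Finset.sum_nonneg fun i _ => mul_nonneg (hR.1.eigenvalues_nonneg i)
    (pow_nonneg (sub_nonneg.mpr (hR.eigenvalues_le_one i)) n)

lemma IsDensity.moment_one_pow_le (hR : IsDensity R) (n : ℕ) :
    moment R 1 ^ n ≤ moment R n := by
  simpa [moment_eq_sum hR.1.1] using Real.pow_arith_mean_le_arith_mean_pow Finset.univ
    hR.1.1.eigenvalues (fun i => 1 - hR.1.1.eigenvalues i)
    (fun i _ => hR.1.eigenvalues_nonneg i) hR.sum_eigenvalues
    (fun i _ => sub_nonneg.mpr (hR.eigenvalues_le_one i)) n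

lemma IsDensity.moment_one_le (hR : IsDensity R) :
    moment R 1 ≤ 1 - 1 / (Fintype.card A : ℝ) := by
  have hs := hR.sum_eigenvalues
  have hA : 0 < (Fintype.card A : ℝ) := by
    rw [Nat.cast_pos, Fintype.card_pos_iff]
    by_contra hA
    rw [not_nonempty_iff] at hA
    simp at hs
  have h := sq_sum_le_card_mul_sum_sq (s := Finset.univ) (f := hR.1.1.eigenvalues)
  rw [hs, Finset.card_univ] at h
  have h' : 1 / (Fintype.card A : ℝ) ≤ ∑ i, hR.1.1.eigenvalues i ^ 2 := by
    rw [div_le_iff₀ hA]; linarith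
  have e : moment R 1 = 1 - ∑ i, hR.1.1.eigenvalues i ^ 2 := by
    conv_rhs => rw [← hs]
    rw [moment_eq_sum hR.1.1, ← Finset.sum_sub_distrib]
    exact Finset.sum_congr rfl fun i _ => by ring
  linarith

lemma IsDensity.hasSum_entropy (hR : IsDensity R) :
    HasSum (fun k : ℕ => moment R (k + 1) / ((k + 1 : ℕ) : ℝ)) (entropy R) := by
  rw [entropy_eq_sum_negMulLog hR.1.1]
  simp only [moment_eq_sum hR.1.1, Finset.sum_div]
  exact hasSum_sum fun i _ => hasSum_negMulLog (hR.1.eigenvalues_nonneg i)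
    (hR.eigenvalues_le_one i)

lemma IsDensity.sum_moment_le_entropy (hR : IsDensity R) (n : ℕ) :
    ∑ k ∈ Finset.Icc 1 n, moment R k / (k : ℝ) ≤ entropy R := by
  rw [← Finset.Ico_add_one_right_eq_Icc, Finset.sum_Ico_eq_sum_range, Nat.add_sub_cancel]
  simp only [add_comm 1]
  exact sum_le_hasSum _ (fun k _ => div_nonneg (hR.moment_nonneg _) (Nat.cast_nonneg _))
    hR.hasSum_entropy

lemma IsDensity.entropy_nonneg (hR : IsDensity R) : 0 ≤ entropy R := by
  rw [entropy_eq_sum_negMulLog hR.1.1]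
  exact Finset.sum_nonneg fun i _ => Real.negMulLog_nonneg (hR.1.eigenvalues_nonneg i)
    (hR.eigenvalues_le_one i)

lemma IsDensity.entropy_le (hR : IsDensity R) : entropy R ≤ Fintype.card A := by
  rw [entropy_eq_sum_negMulLog hR.1.1]
  have : ∀ i ∈ Finset.univ, Real.negMulLog (hR.1.1.eigenvalues i) ≤ 1 := fun i _ => by
    have h := Real.negMulLog_le_one_sub_self (hR.1.eigenvalues_nonneg i)
    linarith [hR.1.eigenvalues_nonneg i]
  simpa using Finset.sum_le_card_nsmul _ _ _ this

end Spectral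

/-! ### The numbers `a_n` as averaged moments of the marginal -/

section PartialTrace

variable {A B : Type*} [Fintype B]

lemma trace_ptraceB [Fintype A] (X : Matrix (A × B) (A × B) ℂ) : (ptraceB X).trace = X.trace := by
  simp [ptraceB, trace, Fintype.sum_prod_type]

lemma posSemidef_ptraceB {X : Matrix (A × B) (A × B) ℂ} (hX : X.PosSemidef) :
    (ptraceB X).PosSemidef := by
  have e : ptraceB X = ∑ k : B, X.submatrix (fun a => (a, k)) (fun a => (a, k)) := by
    ext i j
    simp [ptraceB, Matrix.sum_apply]
  rw [e]
  exact posSemidef_sum _ fun k _ => hX.submatrix _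

lemma trace_mul_kronecker_one [Fintype A] [DecidableEq B] (X : Matrix (A × B) (A × B) ℂ)
    (M : Matrix A A ℂ) :
    (X * (M ⊗ₖ (1 : Matrix B B ℂ))).trace = (ptraceB X * M).trace := by
  simp only [trace, diag_apply, mul_apply, Fintype.sum_prod_type, kroneckerMap_apply, one_apply,
    ptraceB, of_apply, mul_ite, mul_one, mul_zero, Finset.sum_ite_eq', Finset.mem_univ, if_true,
    Finset.sum_mul]
  exact Finset.sum_congr rfl fun a _ => Finset.sum_comm

end PartialTrace

section Bipartite

variable {A B : Type*} [Fintype A] [DecidableEq A] [Fintype B] [DecidableEq B]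
variable {ρ : Matrix (A × B) (A × B) ℂ}

lemma isDensity_marginal (hρ : IsDensity ρ) (U : Matrix.unitaryGroup (A × B) ℂ) :
    IsDensity (marginal ρ U) :=
  ⟨posSemidef_ptraceB (hρ.1.mul_mul_conjTranspose_same _), by
    rw [marginal, trace_ptraceB, trace_unitary_conj, hρ.2]⟩

lemma kronecker_one_pow (M : Matrix A A ℂ) (n : ℕ) :
    (M ⊗ₖ (1 : Matrix B B ℂ)) ^ n = (M ^ n) ⊗ₖ (1 : Matrix B B ℂ) := by
  induction n with
  | zero => simp
  | succ n ih => rw [pow_succ, ih, pow_succ, ← mul_kronecker_mul, Matrix.one_mul]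

lemma Gam_conj_Tmat [Nonempty B] (ρ : Matrix (A × B) (A × B) ℂ)
    (U : Matrix.unitaryGroup (A × B) ℂ) :
    Gam ((U : Matrix (A × B) (A × B) ℂ) * Tmat ρ * (U : Matrix (A × B) (A × B) ℂ)ᴴ) =
      (1 - marginal ρ U) ⊗ₖ (1 : Matrix B B ℂ) := by
  have hU : (U : Matrix (A × B) (A × B) ℂ) * (U : Matrix (A × B) (A × B) ℂ)ᴴ = 1 :=
    mem_unitaryGroup_iff.mp U.2
  rw [Gam, Tmat, Matrix.mul_sub, Matrix.sub_mul, Matrix.mul_smul, Matrix.mul_one,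
    Matrix.smul_mul, hU]
  congr 1
  ext i j
  have hB : (Fintype.card B : ℂ) ≠ 0 := Nat.cast_ne_zero.mpr Fintype.card_ne_zero
  by_cases hij : i = j <;>
    simp [ptraceB, marginal, one_apply, hij, hB]

lemma trace_mul_integrand [Nonempty B] (ρ : Matrix (A × B) (A × B) ℂ) (n : ℕ)
    (U : Matrix.unitaryGroup (A × B) ℂ) :
    (ρ * integrand ρ n U).trace = (marginal ρ U * (1 - marginal ρ U) ^ n).trace := by
  rw [integrand, Gam_conj_Tmat, kronecker_one_pow, marginal, ← trace_mul_kronecker_one,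
    ← Matrix.mul_assoc, trace_mul_comm]
  simp only [Matrix.mul_assoc]

lemma continuous_integrand (ρ : Matrix (A × B) (A × B) ℂ) (n : ℕ) :
    Continuous (integrand ρ n) := by
  have hU : Continuous fun U : Matrix.unitaryGroup (A × B) ℂ => (U : Matrix (A × B) (A × B) ℂ) :=
    continuous_subtype_val
  have hG : Continuous fun U : Matrix.unitaryGroup (A × B) ℂ =>
      Gam ((U : Matrix (A × B) (A × B) ℂ) * Tmat ρ * (U : Matrix (A × B) (A × B) ℂ)ᴴ) := by
    refine continuous_matrix fun x y => ?_
    simp only [Gam, ptraceB, kroneckerMap_apply, of_apply]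
    exact (continuous_finsetSum _ fun k _ =>
      (continuous_orbit (Tmat ρ)).matrix_elem _ _).mul continuous_const
  exact (hU.matrix_conjTranspose.matrix_mul (hG.pow n)).matrix_mul hU

lemma integrable_integrand (ρ : Matrix (A × B) (A × B) ℂ) (n : ℕ) (x y : A × B) :
    Integrable (fun U => integrand ρ n U x y) (haarU (A × B)) :=
  integrable_haarU_of_continuous ((continuous_integrand ρ n).matrix_elem x y)

lemma integrable_moment_marginal (ρ : Matrix (A × B) (A × B) ℂ) (n : ℕ) :
    Integrable (fun U => moment (marginal ρ U) n) (haarU (A × B)) :=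
  integrable_haarU_of_continuous ((continuous_moment n).comp (continuous_marginal ρ))

lemma aTrace_eq_integral [Nonempty B] (ρ : Matrix (A × B) (A × B) ℂ) (n : ℕ) :
    aTrace ρ n = ∫ U, (marginal ρ U * (1 - marginal ρ U) ^ n).trace ∂(haarU (A × B)) := by
  simp only [← trace_mul_integrand]
  simp only [aTrace, integralMat, trace, diag_apply, mul_apply, of_apply]
  refine Eq.trans (Finset.sum_congr rfl fun i _ => ?_) (integral_finsetSum _ fun i _ =>
    integrable_finsetSum _ fun j _ => (integrable_integrand ρ n j i).const_mul (ρ i j)).symm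
  refine Eq.trans ?_ (integral_finsetSum _ fun j _ =>
    (integrable_integrand ρ n j i).const_mul (ρ i j)).symm
  exact Finset.sum_congr rfl fun j _ => (integral_const_mul _ _).symm

lemma IsDensity.nonempty {ι : Type*} [Fintype ι] {σ : Matrix ι ι ℂ} (h : IsDensity σ) :
    Nonempty ι := by
  by_contra hι
  rw [not_nonempty_iff] at hι
  simpa [trace] using h.2

lemma aTrace_eq_ofReal (hρ : IsDensity ρ) (n : ℕ) :
    aTrace ρ n = ((∫ U, moment (marginal ρ U) n ∂(haarU (A × B)) : ℝ) : ℂ) := by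
  have : Nonempty B := hρ.nonempty.map Prod.snd
  rw [aTrace_eq_integral, ← integral_complex_ofReal]
  exact integral_congr_ae (Filter.Eventually.of_forall fun U =>
    (ofReal_moment (isDensity_marginal hρ U).1.1 n).symm)

lemma a_eq_integral (hρ : IsDensity ρ) (n : ℕ) :
    a ρ n = ∫ U, moment (marginal ρ U) n ∂(haarU (A × B)) := by
  rw [a, aTrace_eq_ofReal hρ, Complex.ofReal_re]

/-- The entropy of the marginal is bounded, and measurable as a pointwise limit of continuous
functions. -/
lemma integrable_entropy_marginal (hρ : IsDensity ρ) :
    Integrable (fun U => entropy (marginal ρ U)) (haarU (A × B)) := by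
  refine Integrable.of_bound (C := Fintype.card A) ?_ (Filter.Eventually.of_forall fun U => ?_)
  · refine aestronglyMeasurable_of_tendsto_ae Filter.atTop
      (f := fun (n : ℕ) U => ∑ k ∈ Finset.range n,
        moment (marginal ρ U) (k + 1) / ((k + 1 : ℕ) : ℝ)) (fun n => ?_)
      (Filter.Eventually.of_forall fun U =>
        (isDensity_marginal hρ U).hasSum_entropy.tendsto_sum_nat)
    exact (integrable_finsetSum _ fun k _ =>
      (integrable_moment_marginal ρ (k + 1)).div_const _).aestronglyMeasurable
  · rw [Real.norm_of_nonneg (isDensity_marginal hρ U).entropy_nonneg]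
    exact (isDensity_marginal hρ U).entropy_le

lemma sum_a_le_integral_entropy (hρ : IsDensity ρ) (n : ℕ) :
    ∑ k ∈ Finset.Icc 1 n, a ρ k / (k : ℝ) ≤
      ∫ U, entropy (marginal ρ U) ∂(haarU (A × B)) := by
  simp only [a_eq_integral hρ, ← integral_div]
  rw [← integral_finsetSum _ fun k _ => (integrable_moment_marginal ρ k).div_const _]
  exact integral_mono
    (integrable_finsetSum _ fun k _ => (integrable_moment_marginal ρ k).div_const _)
    (integrable_entropy_marginal hρ) fun U => (isDensity_marginal hρ U).sum_moment_le_entropy n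

lemma a_one_nonneg (hρ : IsDensity ρ) : 0 ≤ a ρ 1 := by
  rw [a_eq_integral hρ]
  exact integral_nonneg fun U => (isDensity_marginal hρ U).moment_nonneg 1

/-- Jensen's inequality, applied both to the spectral distribution of each marginal and to the
Haar measure. -/
lemma a_one_pow_le (hρ : IsDensity ρ) (n : ℕ) : a ρ 1 ^ n ≤ a ρ n := by
  have hint : Integrable (fun U => moment (marginal ρ U) 1 ^ n) (haarU (A × B)) :=
    integrable_haarU_of_continuous
      (((continuous_moment 1).comp (continuous_marginal ρ)).pow n)
  rw [a_eq_integral hρ, a_eq_integral hρ]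
  refine ((convexOn_pow n).map_integral_le (continuous_pow n).continuousOn isClosed_Ici
    (Filter.Eventually.of_forall fun U => (isDensity_marginal hρ U).moment_nonneg 1)
    (integrable_moment_marginal ρ 1) hint).trans ?_
  exact integral_mono hint (integrable_moment_marginal ρ n) fun U =>
    (isDensity_marginal hρ U).moment_one_pow_le n

lemma a_one_lt_one (hρ : IsDensity ρ) : a ρ 1 < 1 := by
  have : Nonempty A := hρ.nonempty.map Prod.fst
  have hA : 0 < 1 / (Fintype.card A : ℝ) := by positivity
  have h := integral_mono (integrable_moment_marginal ρ 1)
    (integrable_const (1 - 1 / (Fintype.card A : ℝ)))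
    fun U => (isDensity_marginal hρ U).moment_one_le
  rw [← a_eq_integral hρ] at h
  rw [integral_const, probReal_univ, one_smul] at h
  linarith

lemma neg_log_one_sub_a_one_le (hρ : IsDensity ρ) :
    -Real.log (1 - a ρ 1) ≤ ∫ U, entropy (marginal ρ U) ∂(haarU (A × B)) := by
  have h0 := a_one_nonneg hρ
  have h := Real.hasSum_pow_div_log_of_abs_lt_one (x := a ρ 1)
    (by rw [abs_of_nonneg h0]; exact a_one_lt_one hρ)
  refine le_of_tendsto' h.tendsto_sum_nat fun n => le_trans ?_ (sum_a_le_integral_entropy hρ n)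
  rw [← Finset.Ico_add_one_right_eq_Icc, Finset.sum_Ico_eq_sum_range, Nat.add_sub_cancel]
  refine Finset.sum_le_sum fun k _ => ?_
  rw [add_comm 1 k, Nat.cast_add_one]
  exact div_le_div_of_nonneg_right (a_one_pow_le hρ (k + 1)) (by positivity)

lemma integrable_trace_marginal_pow (ρ : Matrix (A × B) (A × B) ℂ) (k : ℕ) :
    Integrable (fun U => (marginal ρ U ^ k).trace) (haarU (A × B)) :=
  integrable_haarU_of_continuous ((continuous_marginal ρ).pow k).matrix_trace

lemma ofReal_a_one (hρ : IsDensity ρ) :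
    (a ρ 1 : ℂ) = 1 - ∫ U, (marginal ρ U ^ 2).trace ∂(haarU (A × B)) := by
  have : Nonempty B := hρ.nonempty.map Prod.snd
  rw [a_eq_integral hρ, ← aTrace_eq_ofReal hρ, aTrace_eq_integral]
  have e : ∀ U, (marginal ρ U * (1 - marginal ρ U) ^ 1).trace =
      1 - (marginal ρ U ^ 2).trace := fun U => by
    rw [pow_one, Matrix.mul_sub, Matrix.mul_one, trace_sub, (isDensity_marginal hρ U).2, pow_two]
  simp only [e]
  rw [integral_sub (integrable_const _) (integrable_trace_marginal_pow ρ 2)]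
  simp

lemma ofReal_a_two (hρ : IsDensity ρ) :
    (a ρ 2 : ℂ) = 1 - 2 * ∫ U, (marginal ρ U ^ 2).trace ∂(haarU (A × B)) +
      ∫ U, (marginal ρ U ^ 3).trace ∂(haarU (A × B)) := by
  have : Nonempty B := hρ.nonempty.map Prod.snd
  rw [a_eq_integral hρ, ← aTrace_eq_ofReal hρ, aTrace_eq_integral]
  have e : ∀ U, (marginal ρ U * (1 - marginal ρ U) ^ 2).trace =
      1 - 2 * (marginal ρ U ^ 2).trace + (marginal ρ U ^ 3).trace := fun U => by
    have : marginal ρ U * (1 - marginal ρ U) ^ 2 =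
        marginal ρ U - (2 : ℂ) • marginal ρ U ^ 2 + marginal ρ U ^ 3 := by
      rw [two_smul]; noncomm_ring
    rw [this, trace_add, trace_sub, trace_smul, (isDensity_marginal hρ U).2, smul_eq_mul]
  simp only [e]
  have i2 : Integrable (fun U => 2 * (marginal ρ U ^ 2).trace) (haarU (A × B)) :=
    (integrable_trace_marginal_pow ρ 2).const_mul 2
  have i1 : Integrable (fun U => 1 - 2 * (marginal ρ U ^ 2).trace) (haarU (A × B)) :=
    (integrable_const _).sub i2
  rw [integral_add i1 (integrable_trace_marginal_pow ρ 3), integral_sub (integrable_const _) i2,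
    integral_const_mul]
  simp

theorem a_one_eq (hρ : IsDensity ρ) {dA dB d : ℝ} (hdA : dA = Fintype.card A)
    (hdB : dB = Fintype.card B) (hd : d = dA * dB) (h1 : 1 < d) :
    a ρ 1 = (dA - 1) / (d ^ 2 - 1) * ((1 + d * dB) - (d + dB) * trPow ρ 2) := by
  have hcard : 1 < Fintype.card (A × B) := by
    rw [Fintype.card_prod]
    rw [hd, hdA, hdB] at h1
    exact_mod_cast h1
  have hne : d ^ 2 - 1 ≠ 0 := by nlinarith
  have h := integral_trace_marginal_sq hρ (dA := (dA : ℂ)) (dB := dB) (d := d)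
    (by simp [hdA]) (by simp [hdB]) (by simp [hd]) hcard
  have hr : ∫ U, (marginal ρ U ^ 2).trace ∂(haarU (A × B)) = ((1 - a ρ 1 : ℝ) : ℂ) := by
    push_cast; rw [ofReal_a_one hρ]; ring
  rw [hr] at h
  have h' : (d ^ 2 - 1) * (1 - a ρ 1) = (d - trPow ρ 2) * dB + (d * trPow ρ 2 - 1) * dA := by
    exact_mod_cast h
  rw [div_mul_eq_mul_div, eq_div_iff hne]
  subst hd
  linear_combination -h'

theorem a_two_eq (hρ : IsDensity ρ) {dA dB d : ℝ} (hdA : dA = Fintype.card A)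
    (hdB : dB = Fintype.card B) (hd : d = dA * dB) (h2 : 2 < d) :
    a ρ 2 = (coeffF dA dB (trPow ρ 2) + coeffG dA dB * (1 / dB) + coeffH dA dB * (1 / dB ^ 2))
      - (coeffG dA dB + coeffH dA dB * (2 / dB)) * trPow ρ 2 + coeffH dA dB * trPow ρ 3 := by
  have hcard : 2 < Fintype.card (A × B) := by
    rw [Fintype.card_prod]
    rw [hd, hdA, hdB] at h2
    exact_mod_cast h2
  have hne1 : d ^ 2 - 1 ≠ 0 := by nlinarith
  have hne2 : d ^ 2 - 4 ≠ 0 := by nlinarith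
  have hB : dB ≠ 0 := by
    rintro rfl
    rw [mul_zero] at hd
    linarith
  have h := integral_trace_marginal_cube hρ (dA := (dA : ℂ)) (dB := dB) (d := d)
    (by simp [hdA]) (by simp [hdB]) (by simp [hd]) hcard
  have h1 := a_one_eq hρ hdA hdB hd (by linarith)
  have hr : ∫ U, (marginal ρ U ^ 3).trace ∂(haarU (A × B)) =
      ((a ρ 2 + 1 - 2 * a ρ 1 : ℝ) : ℂ) := by
    push_cast; rw [ofReal_a_two hρ, ofReal_a_one hρ]; ring
  rw [hr] at h
  have h' : (d ^ 2 - 1) * (d ^ 2 - 4) * (a ρ 2 + 1 - 2 * a ρ 1) =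
      dB ^ 2 * (d ^ 2 - 2 - 3 * d * trPow ρ 2 + 4 * trPow ρ 3) +
        3 * d * (-d + (d ^ 2 + 2) * trPow ρ 2 - 2 * d * trPow ρ 3) +
        (dA ^ 2 + 1) * (2 - 3 * d * trPow ρ 2 + d ^ 2 * trPow ρ 3) := by
    exact_mod_cast h
  have e : a ρ 2 = (dB ^ 2 * (d ^ 2 - 2 - 3 * d * trPow ρ 2 + 4 * trPow ρ 3) +
        3 * d * (-d + (d ^ 2 + 2) * trPow ρ 2 - 2 * d * trPow ρ 3) +
        (dA ^ 2 + 1) * (2 - 3 * d * trPow ρ 2 + d ^ 2 * trPow ρ 3)) /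
        ((d ^ 2 - 1) * (d ^ 2 - 4)) - 1 + 2 * a ρ 1 := by
    rw [← h', mul_div_cancel_left₀ _ (mul_ne_zero hne1 hne2)]
    ring
  rw [e, h1, coeffF, coeffG, coeffH, ← hd]
  generalize trPow ρ 2 = p
  generalize trPow ρ 3 = q
  field_simp
  subst hd
  ring

end Bipartite
end UnitaryOrbit

theorem theorem1 {A B : Type*} [Fintype A] [DecidableEq A] [Fintype B] [DecidableEq B]
    (ρ : Matrix (A × B) (A × B) ℂ) (hρ : UnitaryOrbit.IsDensity ρ)
    (dA dB d : ℝ) (hdA : dA = Fintype.card A) (hdB : dB = Fintype.card B) (hd : d = dA * dB) :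
    -- all integrals involved exist, and the numbers `a_n` are real
    Integrable (fun U => UnitaryOrbit.entropy (UnitaryOrbit.marginal ρ U))
      (UnitaryOrbit.haarU (A × B)) ∧
    (∀ (n : ℕ) (x y : A × B), Integrable (fun U => UnitaryOrbit.integrand ρ n U x y)
      (UnitaryOrbit.haarU (A × B))) ∧
    (∀ n : ℕ, UnitaryOrbit.aTrace ρ n = (UnitaryOrbit.a ρ n : ℂ)) ∧
    -- the lower bounds by partial sums
    (∀ n : ℕ, ∑ k ∈ Finset.Icc 1 n, UnitaryOrbit.a ρ k / (k : ℝ) ≤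
      ∫ U, UnitaryOrbit.entropy (UnitaryOrbit.marginal ρ U) ∂(UnitaryOrbit.haarU (A × B))) ∧
    (∀ n : ℕ, UnitaryOrbit.a ρ 1 ^ n ≤ UnitaryOrbit.a ρ n) ∧
    -- the explicit first two terms
    (1 < d → UnitaryOrbit.a ρ 1 =
      (dA - 1) / (d ^ 2 - 1) * ((1 + d * dB) - (d + dB) * UnitaryOrbit.trPow ρ 2)) ∧
    (2 < d → UnitaryOrbit.a ρ 2 =
      (UnitaryOrbit.coeffF dA dB (UnitaryOrbit.trPow ρ 2)
          + UnitaryOrbit.coeffG dA dB * (1 / dB) + UnitaryOrbit.coeffH dA dB * (1 / dB ^ 2))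
        - (UnitaryOrbit.coeffG dA dB + UnitaryOrbit.coeffH dA dB * (2 / dB))
            * UnitaryOrbit.trPow ρ 2
        + UnitaryOrbit.coeffH dA dB * UnitaryOrbit.trPow ρ 3) ∧
    -- the logarithmic lower bound
    UnitaryOrbit.a ρ 1 < 1 ∧
    -Real.log (1 - UnitaryOrbit.a ρ 1) ≤
      ∫ U, UnitaryOrbit.entropy (UnitaryOrbit.marginal ρ U) ∂(UnitaryOrbit.haarU (A × B)) := by
  exact ⟨UnitaryOrbit.integrable_entropy_marginal hρ, UnitaryOrbit.integrable_integrand ρ,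
    fun n => by rw [UnitaryOrbit.aTrace_eq_ofReal hρ, UnitaryOrbit.a_eq_integral hρ],
    UnitaryOrbit.sum_a_le_integral_entropy hρ, UnitaryOrbit.a_one_pow_le hρ,
    UnitaryOrbit.a_one_eq hρ hdA hdB hd, UnitaryOrbit.a_two_eq hρ hdA hdB hd,
    UnitaryOrbit.a_one_lt_one hρ, UnitaryOrbit.neg_log_one_sub_a_one_le hρ⟩
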